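/- Let $d,k,\bar k$ be integers with $1\le k\le \bar k\le d-1$ and let $\varepsilon>0$, $\delta>0$. A dataset $x$ is a finite multiset of subsets of $[d]=\{1,\dots,d\}$ (one subset per user), and two datasets are neighbors if one arises from the other by adding one user's subset (which may be arbitrary, so that all $d$ counts may change). Let $h_j$ be the number of users of $x$ whose subset contains $j$, and let $h_{(1)}\ge h_{(2)}\ge\dots\ge h_{(d)}$ be the sorted counts. The strictly limited domain algorithm acts on $x$ as follows. Put $h_\bot=h_{(\bar k+1)}+1+\ln(\bar k/\delta)/\varepsilon$. For $\bot$ and for every index $i\in[d]$ with $h_i>h_{(\bar k+1)}$ (there are at most $\bar k$ such indices) put $v_\bot=h_\bot+Z_\bot$ and $v_i=h_i+Z_i$, where the $Z$'s are independent Gumbel variables with scale $1/\varepsilon$, i.e. with density $z\mapsto\varepsilon\exp(-(\varepsilon z+e^{-\varepsilon z}))$ on $\mathbb R$. Sort these values in decreasing order and let $i_1,\dots,i_j$ be the indices that precede $\bot$, in this order. Return the sequence $(i_1,\dots,i_j,\bot)$ if $j<k$, and $(i_1,\dots,i_k)$ otherwise. Then for every $\delta'\ge 0$ this algorithm $M$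 is $(\varepsilon',\delta+\delta')$-differentially private, that is, $\Pr[M(x)\in S]\le e^{\varepsilon'}\Pr[M(x')\in S]+\delta+\delta'$ for all neighbors $x,x'$ and all sets $S$ of outcomes, where $$\varepsilon'=\min\left\{k\varepsilon,\; k\varepsilon\,\frac{e^{\varepsilon}-1}{e^{\varepsilon}+1}+\varepsilon\sqrt{2k\ln(1/\delta')},\; \frac{k\varepsilon^2}{2}+\varepsilon\sqrt{\tfrac12 k\ln(1/\delta')}\right\}.$$ For $\delta'=0$ this is read with $\ln(1/\delta')=+\infty$, i.e. $\varepsilon'=k\varepsilon$; for $\delta'>1$ the square roots are read as $0$ (and the claim is trivial). -/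

import Mathlib

noncomputable section

namespace DPTopK

open MeasureTheory

/-- Two datasets (finite multisets of records) are neighbors if one of them is obtained from the
other by adding the data of one user. -/
def Neighbor {X : Type*} (x x' : Multiset X) : Prop :=
  ∃ r : X, x = r ::ₘ x' ∨ x' = r ::ₘ x

/-- `(ε, δ)`-differential privacy of a randomized algorithm `M`, given by the law `M x` of its
output on each dataset `x`. -/
def IsDP {X Y : Type*} [MeasurableSpace Y] (M : Multiset X → Measure Y) (ε δ : ℝ) : Prop :=
  (∀ x, IsProbabilityMeasure (M x)) ∧
    ∀ x x', Neighbor x x' → ∀ S : Set Y, MeasurableSet S →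
      (M x).real S ≤ Real.exp ε * (M x').real S + δ

/-- The histogram of a dataset of subsets of `[d]`: `h j` is the number of users having `j`. -/
def histogram {d : ℕ} (x : Multiset (Finset (Fin d))) (j : Fin d) : ℕ :=
  x.countP (fun r => j ∈ r)

/-- `rankedCount h m` is the `m`-th largest count `h_(m)` of the histogram, for `1 ≤ m ≤ d`
(counted with multiplicity). -/
def rankedCount {d : ℕ} (h : Fin d → ℕ) (m : ℕ) : ℕ :=
  ((List.ofFn h).mergeSort (fun a b => decide (b ≤ a))).getD (m - 1) 0

/-- The density of the Gumbel distribution with scale `b`. -/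
def gumbelPDF (b z : ℝ) : ℝ :=
  1 / b * Real.exp (-(z / b + Real.exp (-z / b)))

/-- The Gumbel distribution with scale `b`. -/
def gumbel (b : ℝ) : Measure ℝ :=
  volume.withDensity (fun z => ENNReal.ofReal (gumbelPDF b z))

/-- An output is an ordered list of indices, `some i` being the index `i ∈ [d]` and `none`
being the symbol `⊥`. -/
abbrev Output (d : ℕ) : Type := List (Option (Fin d))

/-- Every set of outputs is an event. -/
instance (d : ℕ) : MeasurableSpace (Output d) := ⊤

/-- The values before noise is added: `h_i` for an index `i`, and
`h_⊥ = h_(kbar + 1) + 1 + ln (kbar / δ) / ε` for `⊥`. -/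
def score {d : ℕ} (kbar : ℕ) (ε δ : ℝ) (h : Fin d → ℕ) : Option (Fin d) → ℝ
  | some i => (h i : ℝ)
  | none => (rankedCount h (kbar + 1) : ℝ) + 1 + Real.log ((kbar : ℝ) / δ) / ε

/-- The symbol `⊥` and the indices whose count is strictly larger than `h_(kbar + 1)` (there are
at most `kbar` such indices, all of them among the top `kbar`). -/
def candidates {d : ℕ} (kbar : ℕ) (h : Fin d → ℕ) : List (Option (Fin d)) :=
  none :: ((List.finRange d).filter
    (fun i => decide (rankedCount h (kbar + 1) < h i))).map some

/-- From a sorted list, keep the indices before `⊥`; if there are fewer than `k` of them return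
them followed by `⊥`, otherwise return the first `k` of them. -/
def truncate {d : ℕ} (k : ℕ) (l : List (Option (Fin d))) : Output d :=
  let s := l.takeWhile (fun o => o.isSome)
  if s.length < k then s ++ [none] else s.take k

/-- The output of the strictly limited domain algorithm when the noise added to the value of
`o` is `z o`: the candidates are sorted by decreasing noisy value, then truncated. -/
def outputOfNoise {d : ℕ} (k kbar : ℕ) (ε δ : ℝ) (h : Fin d → ℕ) (z : Option (Fin d) → ℝ) :
    Output d :=
  truncate k ((candidates kbar h).mergeSort
    (fun a b => decide (score kbar ε δ h b + z b ≤ score kbar ε δ h a + z a)))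

/-- The strictly limited domain top-`k` algorithm: the law of its output on a dataset, the noise
being independent with distribution Gumbel `(1 / ε)`. -/
def strictTopK (d k kbar : ℕ) (ε δ : ℝ) (x : Multiset (Finset (Fin d))) : Measure (Output d) :=
  (Measure.pi (fun _ : Option (Fin d) => gumbel (1 / ε))).map
    (outputOfNoise k kbar ε δ (histogram x))

/-- The privacy parameter `ε'`. For `δ' = 0` one has `ln (1 / δ') = +∞`, so that only the first
of the three terms is finite. -/
def epsPrime (k : ℕ) (ε δ' : ℝ) : ℝ :=
  if δ' = 0 then k * ε
  else min (k * ε) (min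
    (k * ε * ((Real.exp ε - 1) / (Real.exp ε + 1)) + ε * Real.sqrt (2 * k * Real.log (1 / δ')))
    (k * ε ^ 2 / 2 + ε * Real.sqrt (1 / 2 * k * Real.log (1 / δ'))))

end DPTopK

end

noncomputable section

namespace DPTopK

open MeasureTheory

/-! Sorting scores perturbed by Gumbel noise of scale `1 / ε` draws items one by one without
replacement, each with probability proportional to `exp (ε * score)` (`measureReal_take_sortBy`).
For a fixed candidate list the output depends only on the first `k` items, so it is post-processing
of at most `k` such draws.

Adding a user moves all scores, that of `⊥` included, in one direction by at most 1. The normalised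
weights of one draw then have log-ratios in an interval of length `ε` inside `[-ε, ε]`. The length
enters Hoeffding's lemma and the location bounds the mean loss, by `ε (e ^ ε - 1) / (e ^ ε + 1)`.
Multiplying moment bounds over the draws and applying a Chernoff bound
(`WeightNeighbor.sum_plProb_filter_le`) gives a loss that is below both square-root expressions in
`ε'`; the term `k * ε` is the pointwise bound.

The candidate list itself depends on the data. An index that is a candidate on one side only has
count at most `h_(kbar + 1) + 1`, so it beats `⊥` with probability at most `δ / kbar`, and there are
at most `kbar` such indices. Unless one of them beats `⊥`, replacing the list leaves the output
unchanged (`HistNeighbor.measureReal_outputOn_le`). Making this replacement first, with the scores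
unchanged, keeps `δ` free of a factor `e ^ ε'`. -/

/-! ### Composition of bounded range mechanisms -/

/-- Hoeffding's lemma for a finite distribution. -/
lemma sum_mul_exp_le_of_mem_Icc {α : Type*} (C : Finset α) (p X : α → ℝ) (A B lam : ℝ)
    (hp : ∀ a ∈ C, 0 ≤ p a) (hp1 : ∑ a ∈ C, p a = 1) (hX : ∀ a ∈ C, X a ∈ Set.Icc A B) :
    ∑ a ∈ C, p a * Real.exp (lam * X a) ≤
      Real.exp (lam * (∑ a ∈ C, p a * X a) + lam ^ 2 * (B - A) ^ 2 / 8) := by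
  classical
  let _ : MeasurableSpace α := ⊤
  -- A weighted sum of point masses turns the finite sums into integrals. The sub-Gaussian bound
  -- concerns the centred variable; the mean is restored at the end.
  set μ : Measure α := ∑ a ∈ C, ENNReal.ofReal (p a) • Measure.dirac a with hμ
  have hint : ∀ f : α → ℝ, ∫ x, f x ∂μ = ∑ a ∈ C, p a * f a := by
    intro f
    rw [hμ, integral_finsetSum_measure]
    · refine Finset.sum_congr rfl fun a ha => ?_
      rw [integral_smul_measure, integral_dirac, ENNReal.toReal_ofReal (hp a ha), smul_eq_mul]
    · intro a _
      exact (integrable_dirac (by simp)).smul_measure ENNReal.ofReal_ne_top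
  have hprob : IsProbabilityMeasure μ := by
    constructor
    rw [hμ, Measure.finsetSum_apply]
    simp only [Measure.smul_apply, measure_univ, smul_eq_mul, mul_one]
    rw [← ENNReal.ofReal_sum_of_nonneg hp, hp1, ENNReal.ofReal_one]
  have hae : ∀ᵐ a ∂μ, X a ∈ Set.Icc A B := by
    rw [ae_iff, hμ, Measure.finsetSum_apply]
    refine Finset.sum_eq_zero fun a ha => ?_
    rw [Measure.smul_apply, Measure.dirac_apply' _ (by trivial)]
    simp [Set.indicator, Set.mem_Icc.1 (hX a ha)]
  have h := (ProbabilityTheory.hasSubgaussianMGF_of_mem_Icc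
    (measurable_from_top (f := X)).aemeasurable hae).mgf_le lam
  rw [ProbabilityTheory.mgf, hint, hint] at h
  set m := ∑ a ∈ C, p a * X a
  have h1 : ∑ a ∈ C, p a * Real.exp (lam * X a)
      = Real.exp (lam * m) * ∑ a ∈ C, p a * Real.exp (lam * (X a - m)) := by
    rw [Finset.mul_sum]
    refine Finset.sum_congr rfl fun a _ => ?_
    rw [mul_left_comm, ← Real.exp_add]
    ring_nf
  rw [h1, Real.exp_add]
  refine mul_le_mul_of_nonneg_left (h.trans (le_of_eq ?_)) (Real.exp_pos _).le
  congr 1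
  push_cast
  rw [Real.norm_eq_abs, div_pow, sq_abs]
  ring

/-- The mean of a privacy loss with values in `[-ε, ε]` is at most
`ε (e ^ ε - 1) / (e ^ ε + 1)`. -/
lemma sum_mul_le_of_sum_exp_neg {α : Type*} (C : Finset α) (p X : α → ℝ) {ε : ℝ} (hε : 0 < ε)
    (hp : ∀ a ∈ C, 0 ≤ p a) (hp1 : ∑ a ∈ C, p a = 1)
    (hexp : ∑ a ∈ C, p a * Real.exp (-X a) = 1) (hX : ∀ a ∈ C, X a ∈ Set.Icc (-ε) ε) :
    ∑ a ∈ C, p a * X a ≤ ε * ((Real.exp ε - 1) / (Real.exp ε + 1)) := by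
  set m := ε * ((Real.exp ε - 1) / (Real.exp ε + 1)) with hm
  have he : 1 < Real.exp ε := Real.one_lt_exp_iff.2 hε
  have hinv : Real.exp (-ε) = (Real.exp ε)⁻¹ := Real.exp_neg ε
  -- This `c` makes the convex function `t - c * (1 - exp (-t))` equal to `m` at both endpoints `-ε`
  -- and `ε`. The subtracted term has mean zero because `exp (-X)` has mean 1.
  set c := 2 * ε / (Real.exp ε - Real.exp (-ε)) with hc
  have hlt : Real.exp (-ε) < Real.exp ε := Real.exp_lt_exp.2 (by linarith)
  have hcpos : 0 < c := div_pos (by linarith) (by linarith)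
  have hcv : c = 2 * ε * Real.exp ε / ((Real.exp ε - 1) * (Real.exp ε + 1)) := by
    rw [hc, hinv]
    have : Real.exp ε ≠ 0 := by positivity
    have h1 : Real.exp ε - 1 ≠ 0 := by linarith
    have h2 : Real.exp ε + 1 ≠ 0 := by linarith
    have h3 : Real.exp ε - (Real.exp ε)⁻¹ ≠ 0 := by rw [← hinv]; linarith
    have h4 : Real.exp ε ^ 2 - 1 ≠ 0 := by nlinarith
    field_simp
    ring
  have hconv : ConvexOn ℝ (Set.Icc (-ε) ε) fun t => t - c * (1 - Real.exp (-t)) := by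
    have h1 : ConvexOn ℝ Set.univ fun t : ℝ => Real.exp (-t) := by
      have := convexOn_exp.comp_linearMap (-LinearMap.id : ℝ →ₗ[ℝ] ℝ)
      simpa [Function.comp_def] using this
    have h2 : ConvexOn ℝ Set.univ fun t : ℝ => t + (c * Real.exp (-t) + -c) :=
      (convexOn_id convex_univ).add ((h1.smul hcpos.le).add_const (-c))
    refine (h2.subset (Set.subset_univ _) (convex_Icc _ _)).congr fun t _ => ?_
    simp only
    ring
  have hpt : ∀ t ∈ Set.Icc (-ε) ε, t - c * (1 - Real.exp (-t)) ≤ m := by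
    intro t ht
    have hle := hconv.le_max_of_mem_Icc (Set.left_mem_Icc.2 (by linarith))
      (Set.right_mem_Icc.2 (by linarith)) ht
    refine hle.trans (max_le (le_of_eq ?_) (le_of_eq ?_))
    · have h1 : Real.exp ε - 1 ≠ 0 := by linarith
      have h2 : Real.exp ε + 1 ≠ 0 := by linarith
      rw [hcv, hm, neg_neg]
      field_simp
      ring
    · have h1 : Real.exp ε - 1 ≠ 0 := by linarith
      have h2 : Real.exp ε + 1 ≠ 0 := by linarith
      rw [hcv, hm, hinv]
      field_simp
      ring
  have hsum : ∑ a ∈ C, p a * (X a - c * (1 - Real.exp (-X a))) ≤ ∑ a ∈ C, p a * m :=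
    Finset.sum_le_sum fun a ha => mul_le_mul_of_nonneg_left (hpt _ (hX a ha)) (hp a ha)
  have hl : ∑ a ∈ C, p a * (X a - c * (1 - Real.exp (-X a))) = ∑ a ∈ C, p a * X a := by
    have : ∀ a ∈ C, p a * (X a - c * (1 - Real.exp (-X a)))
        = p a * X a - c * p a + c * (p a * Real.exp (-X a)) := fun a _ => by ring
    rw [Finset.sum_congr rfl this, Finset.sum_add_distrib, Finset.sum_sub_distrib,
      ← Finset.mul_sum, ← Finset.mul_sum, hp1, hexp]
    ring
  rwa [hl, ← Finset.sum_mul, hp1, one_mul] at hsum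

/-- The left side is `tanh (ε / 2)`. After clearing denominators the derivative is nonnegative by `1
- x ≤ exp (-x)`. This turns the mean loss `k * μ` into the term `k * ε ^ 2 / 2` of `epsPrime`. -/
lemma exp_sub_one_div_le_half {ε : ℝ} (hε : 0 ≤ ε) :
    (Real.exp ε - 1) / (Real.exp ε + 1) ≤ ε / 2 := by
  have hmono : MonotoneOn (fun x : ℝ => x * (Real.exp x + 1) - 2 * (Real.exp x - 1))
      (Set.Ici 0) := by
    refine monotoneOn_of_deriv_nonneg (convex_Ici 0) (by fun_prop) (by fun_prop) fun x _ => ?_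
    have hd : HasDerivAt (fun x : ℝ => x * (Real.exp x + 1) - 2 * (Real.exp x - 1))
        (1 * (Real.exp x + 1) + x * Real.exp x - 2 * Real.exp x) x :=
      ((hasDerivAt_id x).mul ((Real.hasDerivAt_exp x).add_const 1)).sub
        (((Real.hasDerivAt_exp x).sub_const 1).const_mul 2)
    rw [hd.deriv]
    have h1 : 1 - x ≤ Real.exp (-x) := by linarith [Real.add_one_le_exp (-x)]
    have h2 := mul_le_mul_of_nonneg_right h1 (Real.exp_pos x).le
    rw [← Real.exp_add, neg_add_cancel, Real.exp_zero] at h2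
    linarith
  have h := hmono (Set.mem_Ici.2 le_rfl) (Set.mem_Ici.2 hε) hε
  simp only [Real.exp_zero] at h
  rw [div_le_div_iff₀ (by positivity) two_pos]
  linarith

/-! ### Sampling without replacement and its privacy loss -/

section PlackettLuce

variable {α : Type*} {w w' : α → ℝ}

lemma sum_div_sum_eq_one (hw : ∀ a, 0 < w a) {C : Finset α} (hC : C.Nonempty) :
    ∑ a ∈ C, w a / ∑ b ∈ C, w b = 1 := by
  rw [← Finset.sum_div, div_self (Finset.sum_pos (fun b _ => hw b) hC).ne']

/-- Two weight functions whose logarithms differ by at most `ε`, all in the same direction. -/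
def WeightNeighbor (ε : ℝ) (w w' : α → ℝ) : Prop :=
  (∀ a, w a ≤ w' a ∧ w' a ≤ Real.exp ε * w a) ∨ (∀ a, w' a ≤ w a ∧ w a ≤ Real.exp ε * w' a)

/-- The log-ratios of the weights all lie in `[0, ε]` or all in `[-ε, 0]`, and the normalising sums
shift them by one common constant. Hence the loss has range `ε` rather than `2 * ε`, which improves
the constant in Hoeffding's lemma. -/
lemma WeightNeighbor.log_mem (hw : ∀ a, 0 < w a) (hw' : ∀ a, 0 < w' a) {ε : ℝ}
    (h : WeightNeighbor ε w w') (C : Finset α) (hC : C.Nonempty) :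
    ∃ B ∈ Set.Icc 0 ε, ∀ a ∈ C, Real.log ((w a / ∑ b ∈ C, w b) / (w' a / ∑ b ∈ C, w' b)) ∈
      Set.Icc (B - ε) B := by
  have hW : 0 < ∑ b ∈ C, w b := Finset.sum_pos (fun b _ => hw b) hC
  have hW' : 0 < ∑ b ∈ C, w' b := Finset.sum_pos (fun b _ => hw' b) hC
  have key : ∀ x y : ℝ, 0 < x → 0 < y → x ≤ y → y ≤ Real.exp ε * x →
      0 ≤ Real.log y - Real.log x ∧ Real.log y - Real.log x ≤ ε := by
    intro x y hx hy hxy hyx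
    have h1 := Real.log_le_log hx hxy
    have h2 := Real.log_le_log hy hyx
    rw [Real.log_mul (Real.exp_pos ε).ne' hx.ne', Real.log_exp] at h2
    constructor <;> linarith
  have hlog : ∀ a, Real.log ((w a / ∑ b ∈ C, w b) / (w' a / ∑ b ∈ C, w' b)) =
      Real.log (w a) - Real.log (∑ b ∈ C, w b) -
        (Real.log (w' a) - Real.log (∑ b ∈ C, w' b)) := by
    intro a
    rw [Real.log_div (div_pos (hw a) hW).ne' (div_pos (hw' a) hW').ne',
      Real.log_div (hw a).ne' hW.ne', Real.log_div (hw' a).ne' hW'.ne']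
  rcases h with h | h
  · have hS := key _ _ hW hW' (Finset.sum_le_sum fun a _ => (h a).1)
      (by rw [Finset.mul_sum]; exact Finset.sum_le_sum fun a _ => (h a).2)
    refine ⟨_, hS, fun a _ => ?_⟩
    have ha := key _ _ (hw a) (hw' a) (h a).1 (h a).2
    rw [hlog]
    constructor <;> linarith [ha.1, ha.2]
  · have hS := key _ _ hW' hW (Finset.sum_le_sum fun a _ => (h a).1)
      (by rw [Finset.mul_sum]; exact Finset.sum_le_sum fun a _ => (h a).2)
    refine ⟨ε - (Real.log (∑ b ∈ C, w b) - Real.log (∑ b ∈ C, w' b)),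
      ⟨by linarith [hS.2], by linarith [hS.1]⟩, fun a _ => ?_⟩
    have ha := key _ _ (hw' a) (hw a) (h a).1 (h a).2
    rw [hlog]
    constructor <;> linarith [ha.1, ha.2]

/-- The bound on the exponential moment of the privacy loss of a single draw. -/
lemma WeightNeighbor.sum_rpow_le (hw : ∀ a, 0 < w a) (hw' : ∀ a, 0 < w' a) {ε : ℝ} (hε : 0 < ε)
    (h : WeightNeighbor ε w w') {lam : ℝ} (hlam : 0 ≤ lam) (C : Finset α) (hC : C.Nonempty) :
    ∑ a ∈ C, (w a / ∑ b ∈ C, w b) * ((w a / ∑ b ∈ C, w b) / (w' a / ∑ b ∈ C, w' b)) ^ lam ≤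
      Real.exp (lam * (ε * ((Real.exp ε - 1) / (Real.exp ε + 1))) + lam ^ 2 * ε ^ 2 / 8) := by
  have hW : 0 < ∑ b ∈ C, w b := Finset.sum_pos (fun b _ => hw b) hC
  have hW' : 0 < ∑ b ∈ C, w' b := Finset.sum_pos (fun b _ => hw' b) hC
  obtain ⟨B, hB, hX⟩ := h.log_mem hw hw' C hC
  set p : α → ℝ := fun a => w a / ∑ b ∈ C, w b with hpdef
  set q : α → ℝ := fun a => w' a / ∑ b ∈ C, w' b with hqdef
  have hp : ∀ a, 0 < p a := fun a => div_pos (hw a) hW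
  have hq : ∀ a, 0 < q a := fun a => div_pos (hw' a) hW'
  set X : α → ℝ := fun a => Real.log (p a / q a) with hXdef
  have hX' : ∀ a ∈ C, X a ∈ Set.Icc (B - ε) B := hX
  have h1 := sum_mul_exp_le_of_mem_Icc C p X (B - ε) B lam (fun a _ => (hp a).le)
    (sum_div_sum_eq_one hw hC) hX'
  have h2 := sum_mul_le_of_sum_exp_neg C p X hε (fun a _ => (hp a).le)
    (sum_div_sum_eq_one hw hC) (by
      -- The mean of `exp (-X)` under `p` is the total mass of `q`.
      rw [← sum_div_sum_eq_one hw' hC]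
      refine Finset.sum_congr rfl fun a _ => ?_
      rw [hXdef, ← Real.log_inv, Real.exp_log (inv_pos.2 (div_pos (hp a) (hq a))), inv_div,
        mul_div_cancel₀ _ (hp a).ne'])
    (fun a ha => ⟨by linarith [(hX' a ha).1, hB.1], by linarith [(hX' a ha).2, hB.2]⟩)
  have h3 : ∀ a ∈ C, p a * (p a / q a) ^ lam = p a * Real.exp (lam * X a) := by
    intro a _
    rw [Real.rpow_def_of_pos (div_pos (hp a) (hq a)), mul_comm lam]
  rw [show ∑ a ∈ C, (w a / ∑ b ∈ C, w b) * ((w a / ∑ b ∈ C, w b) / (w' a / ∑ b ∈ C, w' b)) ^ lam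
    = ∑ a ∈ C, p a * (p a / q a) ^ lam from rfl, Finset.sum_congr rfl h3]
  refine h1.trans (Real.exp_le_exp.2 ?_)
  rw [sub_sub_cancel]
  linarith [mul_le_mul_of_nonneg_left h2 hlam]

variable [DecidableEq α]

/-- The probability of the ordered list `l` when items are drawn one by one from `C` without
replacement, with probability proportional to `w`. -/
def plProb (w : α → ℝ) : Finset α → List α → ℝ
  | _, [] => 1
  | C, a :: l => w a / (∑ b ∈ C, w b) * plProb w (C.erase a) l

/-- The lists of `k` distinct elements of `C`. -/
def arrangements : ℕ → Finset α → Finset (List α)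
  | 0, _ => {[]}
  | k + 1, C => C.biUnion fun a => (arrangements k (C.erase a)).image (a :: ·)

lemma sum_arrangements_succ (k : ℕ) (C : Finset α) (F : List α → ℝ) :
    ∑ l ∈ arrangements (k + 1) C, F l =
      ∑ a ∈ C, ∑ l ∈ arrangements k (C.erase a), F (a :: l) := by
  rw [arrangements, Finset.sum_biUnion]
  · refine Finset.sum_congr rfl fun a _ => ?_
    rw [Finset.sum_image fun _ _ _ _ h => (List.cons.inj h).2]
  · intro a _ b _ hab
    simp only [Function.onFun]
    rw [Finset.disjoint_left]
    rintro l hl hl'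
    obtain ⟨m, _, rfl⟩ := Finset.mem_image.1 hl
    obtain ⟨m', _, h⟩ := Finset.mem_image.1 hl'
    exact hab (List.cons.inj h).1.symm

lemma mem_arrangements {k : ℕ} {C : Finset α} {l : List α} :
    l ∈ arrangements k C ↔ l.length = k ∧ l.Nodup ∧ ∀ a ∈ l, a ∈ C := by
  induction k generalizing C l with
  | zero => simp +contextual [arrangements, List.length_eq_zero_iff]
  | succ k ih =>
    simp only [arrangements, Finset.mem_biUnion, Finset.mem_image, ih]
    constructor
    · rintro ⟨a, ha, m, ⟨hm, hnd, hmem⟩, rfl⟩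
      refine ⟨by simp [hm], List.nodup_cons.2 ⟨fun h => ?_, hnd⟩, ?_⟩
      · exact Finset.notMem_erase a C (hmem a h)
      · intro b hb
        rcases List.mem_cons.1 hb with rfl | hb
        · exact ha
        · exact Finset.mem_of_mem_erase (hmem b hb)
    · rintro ⟨hlen, hnd, hmem⟩
      cases l with
      | nil => simp at hlen
      | cons a m =>
        obtain ⟨ham, hnd⟩ := List.nodup_cons.1 hnd
        refine ⟨a, hmem a (by simp), m, ⟨by simpa using hlen, hnd, fun b hb => ?_⟩, rfl⟩
        exact Finset.mem_erase.2 ⟨fun h => ham (h ▸ hb), hmem b (by simp [hb])⟩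

lemma plProb_pos (hw : ∀ a, 0 < w a) (C : Finset α) (l : List α) (hnd : l.Nodup)
    (hl : ∀ a ∈ l, a ∈ C) : 0 < plProb w C l := by
  induction l generalizing C with
  | nil => simp [plProb]
  | cons a l ih =>
    obtain ⟨hal, hnd⟩ := List.nodup_cons.1 hnd
    refine mul_pos (div_pos (hw a) (Finset.sum_pos (fun b _ => hw b) ⟨a, hl a (by simp)⟩))
      (ih _ hnd fun b hb => ?_)
    exact Finset.mem_erase.2 ⟨fun h => hal (h ▸ hb), hl b (by simp [hb])⟩

lemma plProb_pos_of_mem (hw : ∀ a, 0 < w a) {k : ℕ} {C : Finset α} {l : List α}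
    (h : l ∈ arrangements k C) : 0 < plProb w C l :=
  plProb_pos hw C l (mem_arrangements.1 h).2.1 (mem_arrangements.1 h).2.2

lemma sum_plProb (hw : ∀ a, 0 < w a) (k : ℕ) (C : Finset α) (hk : k ≤ C.card) :
    ∑ l ∈ arrangements k C, plProb w C l = 1 := by
  induction k generalizing C with
  | zero => simp [arrangements, plProb]
  | succ k ih =>
    have hC : C.Nonempty := Finset.card_pos.1 (by omega)
    rw [sum_arrangements_succ, ← sum_div_sum_eq_one hw hC]
    refine Finset.sum_congr rfl fun a ha => ?_
    simp only [plProb]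
    rw [← Finset.mul_sum, ih _ (by rw [Finset.card_erase_of_mem ha]; omega), mul_one]

/-- The likelihood ratio factors along the draws. Given the first item `a`, what remains is the same
problem on `C.erase a`, and `hstep` is uniform in the remaining set, so every draw costs one factor
`b`. -/
lemma sum_plProb_mul_rpow_le (hw : ∀ a, 0 < w a) (hw' : ∀ a, 0 < w' a) {lam b : ℝ} (hb : 0 ≤ b)
    (hstep : ∀ C : Finset α, C.Nonempty → ∑ a ∈ C, (w a / ∑ b ∈ C, w b) *
      ((w a / ∑ b ∈ C, w b) / (w' a / ∑ b ∈ C, w' b)) ^ lam ≤ b)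
    (k : ℕ) (C : Finset α) (hk : k ≤ C.card) :
    ∑ l ∈ arrangements k C, plProb w C l * (plProb w C l / plProb w' C l) ^ lam ≤ b ^ k := by
  induction k generalizing C with
  | zero => simp [arrangements, plProb]
  | succ k ih =>
    have hC : C.Nonempty := Finset.card_pos.1 (by omega)
    have hW : 0 < ∑ b ∈ C, w b := Finset.sum_pos (fun b _ => hw b) hC
    have hW' : 0 < ∑ b ∈ C, w' b := Finset.sum_pos (fun b _ => hw' b) hC
    rw [sum_arrangements_succ, pow_succ']
    calc _ = ∑ a ∈ C, (w a / ∑ b ∈ C, w b) *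
          ((w a / ∑ b ∈ C, w b) / (w' a / ∑ b ∈ C, w' b)) ^ lam *
          ∑ l ∈ arrangements k (C.erase a), plProb w (C.erase a) l *
            (plProb w (C.erase a) l / plProb w' (C.erase a) l) ^ lam := by
          refine Finset.sum_congr rfl fun a _ => ?_
          rw [Finset.mul_sum]
          refine Finset.sum_congr rfl fun l hl => ?_
          simp only [plProb]
          rw [mul_div_mul_comm, Real.mul_rpow
            (div_pos (div_pos (hw a) hW) (div_pos (hw' a) hW')).le
            (div_pos (plProb_pos_of_mem hw hl) (plProb_pos_of_mem hw' hl)).le]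
          ring
      _ ≤ ∑ a ∈ C, (w a / ∑ b ∈ C, w b) *
          ((w a / ∑ b ∈ C, w b) / (w' a / ∑ b ∈ C, w' b)) ^ lam * b ^ k := by
          refine Finset.sum_le_sum fun a ha => mul_le_mul_of_nonneg_left
            (ih _ (by rw [Finset.card_erase_of_mem ha]; omega)) ?_
          have := hw a
          have := hw' a
          positivity
      _ ≤ _ := by
          rw [← Finset.sum_mul]
          exact mul_le_mul_of_nonneg_right (hstep C hC) (by positivity)

lemma WeightNeighbor.plProb_le (hw : ∀ a, 0 < w a) (hw' : ∀ a, 0 < w' a) {ε : ℝ}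
    (h : WeightNeighbor ε w w') (k : ℕ) (C : Finset α) (l : List α)
    (hl : l ∈ arrangements k C) : plProb w C l ≤ Real.exp (k * ε) * plProb w' C l := by
  induction k generalizing C l with
  | zero =>
    obtain rfl : l = [] := by simpa [arrangements] using hl
    simp [plProb]
  | succ k ih =>
    simp only [arrangements, Finset.mem_biUnion, Finset.mem_image] at hl
    obtain ⟨a, ha, m, hm, rfl⟩ := hl
    have hW : 0 < ∑ b ∈ C, w b := Finset.sum_pos (fun b _ => hw b) ⟨a, ha⟩
    have hW' : 0 < ∑ b ∈ C, w' b := Finset.sum_pos (fun b _ => hw' b) ⟨a, ha⟩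
    obtain ⟨B, hB, hX⟩ := h.log_mem hw hw' C ⟨a, ha⟩
    have h1 : w a / ∑ b ∈ C, w b ≤ Real.exp ε * (w' a / ∑ b ∈ C, w' b) := by
      have := (hX a ha).2.trans hB.2
      rwa [Real.log_le_iff_le_exp (div_pos (div_pos (hw a) hW) (div_pos (hw' a) hW')),
        div_le_iff₀ (div_pos (hw' a) hW')] at this
    simp only [plProb]
    calc _ ≤ (Real.exp ε * (w' a / ∑ b ∈ C, w' b)) *
          (Real.exp (k * ε) * plProb w' (C.erase a) m) :=
          mul_le_mul h1 (ih _ _ hm) (plProb_pos_of_mem hw hm).le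
            (mul_pos (Real.exp_pos _) (div_pos (hw' a) hW')).le
      _ = _ := by
          push_cast
          rw [add_mul, one_mul, Real.exp_add]
          ring

/-- Composition: drawing `n ≤ k` items without replacement is private. -/
theorem WeightNeighbor.sum_plProb_filter_le (hw : ∀ a, 0 < w a) (hw' : ∀ a, 0 < w' a) {ε δ' : ℝ}
    (hε : 0 < ε) (h : WeightNeighbor ε w w') (hδ' : 0 ≤ δ') (hδ1 : δ' < 1) {n k : ℕ}
    (hk : 1 ≤ k) (hnk : n ≤ k) (C : Finset α) (hn : n ≤ C.card) (P : List α → Prop)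
    [DecidablePred P] :
    ∑ l ∈ (arrangements n C).filter P, plProb w C l ≤
      Real.exp (epsPrime k ε δ') * (∑ l ∈ (arrangements n C).filter P, plProb w' C l) + δ' := by
  have hpure : ∑ l ∈ (arrangements n C).filter P, plProb w C l ≤
      Real.exp (k * ε) * (∑ l ∈ (arrangements n C).filter P, plProb w' C l) := by
    rw [Finset.mul_sum]
    refine Finset.sum_le_sum fun l hl => ?_
    have hl' := (Finset.mem_filter.1 hl).1
    refine (h.plProb_le hw hw' n C l hl').trans (mul_le_mul_of_nonneg_right ?_
      (plProb_pos_of_mem hw' hl').le)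
    have : (n : ℝ) ≤ k := by exact_mod_cast hnk
    exact Real.exp_le_exp.2 (mul_le_mul_of_nonneg_right this hε.le)
  rcases hδ'.eq_or_lt with rfl | hpos
  -- At `δ' = 0` the real logarithm of `1 / δ'` would be the default value 0, so this case rests on
  -- the pure bound alone.
  · simpa [epsPrime] using hpure
  set μ := ε * ((Real.exp ε - 1) / (Real.exp ε + 1)) with hμ
  set L := Real.log (1 / δ') with hL
  have hLpos : 0 < L := Real.log_pos (by rw [lt_div_iff₀ hpos]; linarith)
  have hk0 : (0 : ℝ) < k := by exact_mod_cast hk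
  set t := ε * Real.sqrt (1 / 2 * k * L) with ht
  have htpos : 0 < t := by positivity
  have htsq : t ^ 2 = ε ^ 2 * (1 / 2 * k * L) := by
    rw [ht, mul_pow, Real.sq_sqrt (by positivity)]
  have hμ0 : 0 ≤ μ := by
    have : 1 < Real.exp ε := Real.one_lt_exp_iff.2 hε
    exact mul_nonneg hε.le (div_nonneg (by linarith) (by linarith))
  set η := k * μ + t with hη
  have hadv : ∑ l ∈ (arrangements n C).filter P, plProb w C l ≤
      Real.exp η * (∑ l ∈ (arrangements n C).filter P, plProb w' C l) + δ' := by
    -- The minimiser of the Chernoff exponent `-lam * t + k * lam ^ 2 * ε ^ 2 / 8`; by the choice of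
    -- `t` the minimum is `-L`.
    set lam := 4 * t / (k * ε ^ 2) with hlam
    have hlam0 : 0 < lam := by positivity
    have hmom := sum_plProb_mul_rpow_le hw hw' (Real.exp_pos _).le
      (fun C hC => h.sum_rpow_le hw hw' hε hlam0.le C hC) n C hn
    rw [← hμ] at hmom
    -- Markov's inequality term by term: where the ratio exceeds `exp η`, its power `lam` is at
    -- least `exp (lam * η)`.
    have hterm : ∀ l ∈ (arrangements n C).filter P, plProb w C l ≤
        Real.exp η * plProb w' C l + Real.exp (-(lam * η)) *
          (plProb w C l * (plProb w C l / plProb w' C l) ^ lam) := by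
      intro l hl
      have hp := plProb_pos_of_mem hw (Finset.mem_filter.1 hl).1
      have hq := plProb_pos_of_mem hw' (Finset.mem_filter.1 hl).1
      rcases le_total (plProb w C l) (Real.exp η * plProb w' C l) with hle | hle
      · have : 0 ≤ Real.exp (-(lam * η)) *
          (plProb w C l * (plProb w C l / plProb w' C l) ^ lam) := by positivity
        linarith
      · have hr : Real.exp η ≤ plProb w C l / plProb w' C l := (le_div_iff₀ hq).2 hle
        have h1 : Real.exp (lam * η) ≤ (plProb w C l / plProb w' C l) ^ lam := by
          rw [mul_comm, Real.exp_mul]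
          exact Real.rpow_le_rpow (Real.exp_pos _).le hr hlam0.le
        have h2 : plProb w C l ≤ Real.exp (-(lam * η)) *
            (plProb w C l * (plProb w C l / plProb w' C l) ^ lam) := by
          calc plProb w C l = Real.exp (-(lam * η)) * (plProb w C l * Real.exp (lam * η)) := by
                rw [mul_left_comm, ← Real.exp_add, neg_add_cancel, Real.exp_zero, mul_one]
            _ ≤ _ := by gcongr
        have : 0 ≤ Real.exp η * plProb w' C l := by positivity
        linarith
    refine (Finset.sum_le_sum hterm).trans ?_
    rw [Finset.sum_add_distrib, ← Finset.mul_sum, ← Finset.mul_sum]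
    refine add_le_add le_rfl ?_
    calc _ ≤ Real.exp (-(lam * η)) * ∑ l ∈ arrangements n C,
          plProb w C l * (plProb w C l / plProb w' C l) ^ lam := by
          refine mul_le_mul_of_nonneg_left ?_ (Real.exp_pos _).le
          refine Finset.sum_le_sum_of_subset_of_nonneg (Finset.filter_subset _ _)
            fun l hl _ => ?_
          have hp := plProb_pos_of_mem hw hl
          have hq := plProb_pos_of_mem hw' hl
          positivity
      _ ≤ Real.exp (-(lam * η)) * Real.exp (lam * μ + lam ^ 2 * ε ^ 2 / 8) ^ k := by
          refine mul_le_mul_of_nonneg_left (hmom.trans ?_) (Real.exp_pos _).le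
          exact pow_le_pow_right₀ (Real.one_le_exp (by positivity)) hnk
      _ = Real.exp (-L) := by
          rw [← Real.exp_nat_mul, ← Real.exp_add]
          congr 1
          have hlt : lam * t = 2 * L := by
            rw [hlam, div_mul_eq_mul_div, mul_assoc, ← sq, htsq]
            field_simp
            ring
          have hl2 : k * (lam ^ 2 * ε ^ 2 / 8) = L := by
            rw [hlam, div_pow, mul_pow, htsq]
            field_simp
            ring
          rw [hη]
          linear_combination (-1 : ℝ) * hlt + hl2
      _ = δ' := by rw [hL, one_div, Real.log_inv, neg_neg, Real.exp_log hpos]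
  have hq0 : 0 ≤ ∑ l ∈ (arrangements n C).filter P, plProb w' C l :=
    Finset.sum_nonneg fun l hl => (plProb_pos_of_mem hw' (Finset.mem_filter.1 hl).1).le
  have hB : η ≤ k * ε * ((Real.exp ε - 1) / (Real.exp ε + 1)) + ε * Real.sqrt (2 * k * L) := by
    have : Real.sqrt (1 / 2 * k * L) ≤ Real.sqrt (2 * k * L) := by
      refine Real.sqrt_le_sqrt ?_
      have : 0 < k * L := by positivity
      nlinarith
    rw [hη, ht, hμ, ← mul_assoc]
    have := mul_le_mul_of_nonneg_left this hε.le
    linarith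
  have hC : η ≤ k * ε ^ 2 / 2 + ε * Real.sqrt (1 / 2 * k * L) := by
    have h1 := mul_le_mul_of_nonneg_left (exp_sub_one_div_le_half hε.le) hε.le
    have h2 := mul_le_mul_of_nonneg_left h1 hk0.le
    rw [hη, ht, hμ]
    nlinarith
  have hmin : k * ε ≤ epsPrime k ε δ' ∨ η ≤ epsPrime k ε δ' := by
    rw [epsPrime, if_neg hpos.ne']
    rcases min_choice ((k : ℝ) * ε) (min
      (k * ε * ((Real.exp ε - 1) / (Real.exp ε + 1)) + ε * Real.sqrt (2 * k * L))
      (k * ε ^ 2 / 2 + ε * Real.sqrt (1 / 2 * k * L))) with he | he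
    · exact Or.inl he.ge
    · exact Or.inr ((le_min hB hC).trans he.ge)
  rcases hmin with hm | hm
  · have := mul_le_mul_of_nonneg_right (Real.exp_le_exp.2 hm) hq0
    linarith
  · have := mul_le_mul_of_nonneg_right (Real.exp_le_exp.2 hm) hq0
    linarith

end PlackettLuce

/-! ### The order statistics of Gumbel noise -/

section Gumbel

variable {ε : ℝ}

lemma gumbelPDF_one_div (hε : 0 < ε) (z : ℝ) :
    gumbelPDF (1 / ε) z = ε * Real.exp (-(ε * z)) * Real.exp (-Real.exp (-(ε * z))) := by
  rw [gumbelPDF, mul_assoc, ← Real.exp_add, one_div_one_div]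
  have h1 : z / (1 / ε) = ε * z := by field_simp
  have h2 : -z / (1 / ε) = -(ε * z) := by field_simp
  rw [h1, h2, neg_add]

lemma measurable_gumbelPDF (b : ℝ) : Measurable (gumbelPDF b) := by
  unfold gumbelPDF
  fun_prop

/-- The Gumbel density is the derivative of `exp (-exp (-(ε * v)))`, so the extra factor only
replaces the coefficient 1 in the exponent by `1 + c`, and the antiderivative is explicit. In the
chain computation `c` is the weight of the remaining items relative to the current one; `c = 0`
gives the distribution function. -/
lemma setLIntegral_gumbel (hε : 0 < ε) {c : ℝ} (hc : 0 ≤ c) (t : ℝ) :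
    ∫⁻ v in Set.Iic t, ENNReal.ofReal (Real.exp (-(c * Real.exp (-(ε * v))))) ∂gumbel (1 / ε) =
      ENNReal.ofReal (1 / (1 + c) * Real.exp (-((1 + c) * Real.exp (-(ε * t))))) := by
  have hc1 : 0 < 1 + c := by linarith
  set g : ℝ → ℝ := fun v => 1 / (1 + c) * Real.exp (-((1 + c) * Real.exp (-(ε * v)))) with hg
  set g' : ℝ → ℝ := fun v =>
    ε * Real.exp (-(ε * v)) * Real.exp (-((1 + c) * Real.exp (-(ε * v)))) with hg'
  have hg'0 : ∀ v, 0 ≤ g' v := fun v => by positivity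
  have hcont : Continuous g' := by fun_prop
  have hderiv : ∀ v, HasDerivAt g (g' v) v := by
    intro v
    have h1 : HasDerivAt (fun v : ℝ => -(ε * v)) (-ε) v := by
      simpa using (hasDerivAt_id v).const_mul (-ε)
    have h2 := ((h1.exp.const_mul (1 + c)).neg.exp).const_mul (1 / (1 + c))
    refine h2.congr_deriv ?_
    rw [hg']
    field_simp
    rfl
  have hlim : Filter.Tendsto g Filter.atBot (nhds 0) := by
    have h1 : Filter.Tendsto (fun v : ℝ => -(ε * v)) Filter.atBot Filter.atTop :=
      Filter.tendsto_neg_atBot_atTop.comp (Filter.tendsto_id.const_mul_atBot hε)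
    have h2 : Filter.Tendsto (fun v : ℝ => (1 + c) * Real.exp (-(ε * v))) Filter.atBot
        Filter.atTop := (Real.tendsto_exp_atTop.comp h1).const_mul_atTop hc1
    have h3 := (Real.tendsto_exp_neg_atTop_nhds_zero.comp h2).const_mul (1 / (1 + c))
    simpa [hg, Function.comp_def] using h3
  have hint : IntegrableOn g' (Set.Iic t) := by
    refine integrableOn_Iic_of_intervalIntegral_norm_tendsto (g t - 0) t
      (fun i => (hcont.integrableOn_Icc).mono_set Set.Ioc_subset_Icc_self)
      Filter.tendsto_id ((tendsto_const_nhds.sub hlim).congr fun x => ?_)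
    simp only [Real.norm_of_nonneg (hg'0 _), id]
    exact (intervalIntegral.integral_eq_sub_of_hasDerivAt (fun v _ => hderiv v)
      (hcont.intervalIntegrable _ _)).symm
  rw [gumbel, setLIntegral_withDensity_eq_setLIntegral_mul _
    (measurable_gumbelPDF _).ennreal_ofReal (by fun_prop) measurableSet_Iic]
  have hval : ∫ v in Set.Iic t, g' v = g t := by
    rw [integral_Iic_of_hasDerivAt_of_tendsto' (fun v _ => hderiv v) hint hlim, sub_zero]
  rw [← show g t = 1 / (1 + c) * Real.exp (-((1 + c) * Real.exp (-(ε * t)))) from rfl, ← hval,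
    ofReal_integral_eq_lintegral_ofReal hint (Filter.Eventually.of_forall hg'0)]
  refine lintegral_congr fun v => ?_
  rw [Pi.mul_apply, gumbelPDF_one_div hε, ← ENNReal.ofReal_mul (by positivity), mul_assoc,
    ← Real.exp_add]
  congr 3
  ring

lemma gumbel_Iic (hε : 0 < ε) (t : ℝ) :
    gumbel (1 / ε) (Set.Iic t) = ENNReal.ofReal (Real.exp (-Real.exp (-(ε * t)))) := by
  have := setLIntegral_gumbel hε le_rfl t
  simpa using this

lemma isProbabilityMeasure_gumbel (hε : 0 < ε) : IsProbabilityMeasure (gumbel (1 / ε)) := by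
  constructor
  have h1 : Filter.Tendsto (fun t : ℝ => gumbel (1 / ε) (Set.Iic t)) Filter.atTop
      (nhds (gumbel (1 / ε) Set.univ)) := tendsto_measure_Iic_atTop _
  have h2 : Filter.Tendsto (fun t : ℝ => ENNReal.ofReal (Real.exp (-Real.exp (-(ε * t)))))
      Filter.atTop (nhds (ENNReal.ofReal (Real.exp (-0)))) := by
    refine ENNReal.tendsto_ofReal ((Real.continuous_exp.tendsto _).comp (Filter.Tendsto.neg ?_))
    exact Real.tendsto_exp_neg_atTop_nhds_zero.comp (Filter.tendsto_id.const_mul_atTop hε)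
  simp only [gumbel_Iic hε] at h1
  simpa using tendsto_nhds_unique h1 h2

end Gumbel

/-! ### Probability of a prescribed order of noisy values -/

section Chain

variable {α : Type*}

/-- The event that the noisy values of the items of `l` are decreasing, at most `t`, and at least
those of the items of `R`. -/
def chainEvent (s : α → ℝ) (R : Finset α) : List α → ℝ → Set (α → ℝ)
  | [], t => {z | ∀ r ∈ R, s r + z r ≤ t}
  | a :: l, t => {z | s a + z a ≤ t ∧ z ∈ chainEvent s R l (s a + z a)}

/-- Joint measurability in the cap and the noise is needed because the recursive cap `s a + z a`
itself depends on the noise. -/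
lemma measurableSet_chainEvent_prod (s : α → ℝ) (R : Finset α) (l : List α) :
    MeasurableSet {p : ℝ × (α → ℝ) | p.2 ∈ chainEvent s R l p.1} := by
  induction l with
  | nil =>
    have h : {p : ℝ × (α → ℝ) | p.2 ∈ chainEvent s R [] p.1} =
        ⋂ r ∈ R, {p : ℝ × (α → ℝ) | s r + p.2 r ≤ p.1} := by
      ext p
      simp [chainEvent]
    rw [h]
    refine Finset.measurableSet_biInter _ fun r _ => ?_
    exact measurableSet_le (f := fun p : ℝ × (α → ℝ) => s r + p.2 r) (by fun_prop) (by fun_prop)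
  | cons a l ih =>
    refine (measurableSet_le (f := fun p : ℝ × (α → ℝ) => s a + p.2 a) (g := Prod.fst) (by fun_prop) (by fun_prop)).inter ?_
    have : Measurable fun p : ℝ × (α → ℝ) => (s a + p.2 a, p.2) := by fun_prop
    exact this ih

lemma measurableSet_chainEvent (s : α → ℝ) (R : Finset α) (l : List α) (t : ℝ) :
    MeasurableSet (chainEvent s R l t) :=
  (measurable_prodMk_left (x := t)) (measurableSet_chainEvent_prod s R l)

lemma mem_chainEvent {s : α → ℝ} {R : Finset α} {l : List α} {t : ℝ} {z : α → ℝ}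
    (hl : l.Pairwise fun a b => s b + z b ≤ s a + z a)
    (hR : ∀ a ∈ l, ∀ r ∈ R, s r + z r ≤ s a + z a)
    (ht : ∀ a, s a + z a ≤ t) : z ∈ chainEvent s R l t := by
  suffices h : ∀ t, (∀ a ∈ l, s a + z a ≤ t) → (∀ r ∈ R, s r + z r ≤ t) →
      z ∈ chainEvent s R l t from h t (fun a _ => ht a) fun r _ => ht r
  clear ht t
  induction l with
  | nil => exact fun t _ h => h
  | cons a l ih =>
    intro t h1 _
    obtain ⟨ha, hl⟩ := List.pairwise_cons.1 hl
    exact ⟨h1 a (by simp), ih hl (fun b hb => hR b (by simp [hb])) _ ha (hR a (by simp))⟩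

lemma chainEvent_mono {s : α → ℝ} {R : Finset α} {l : List α} :
    Monotone (chainEvent s R l) := by
  intro t t' h z hz
  cases l with
  | nil => exact fun r hr => (hz r hr).trans h
  | cons a l => exact ⟨hz.1.trans h, hz.2⟩

variable [DecidableEq α] {ε : ℝ}

lemma lmarginal_eval_of_notMem {μ : α → Measure ℝ} {T : Finset α} {a : α} (ha : a ∉ T)
    (F : ℝ → (α → ℝ) → ENNReal) (x : α → ℝ) :
    lmarginal μ T (fun z => F (z a) z) x = lmarginal μ T (F (x a)) x := by
  simp only [lmarginal, Function.updateFinset, ha, dif_neg, not_false_eq_true]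

lemma lmarginal_forall_le (hε : 0 < ε) (s : α → ℝ) (C : Finset α) (t : ℝ) (x : α → ℝ) :
    lmarginal (fun _ => gumbel (1 / ε)) C ({z | ∀ r ∈ C, s r + z r ≤ t}.indicator 1) x =
      ENNReal.ofReal (Real.exp (-((∑ a ∈ C, Real.exp (ε * s a)) * Real.exp (-(ε * t))))) := by
  have := isProbabilityMeasure_gumbel hε
  have h1 : ∀ y : C → ℝ, ({z | ∀ r ∈ C, s r + z r ≤ t}.indicator 1
      (Function.updateFinset x C y) : ENNReal) =
      (Set.univ.pi fun r : C => Set.Iic (t - s r)).indicator 1 y := by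
    intro y
    refine Set.indicator_eq_indicator ?_ rfl
    simp only [Set.mem_ofPred_eq, Set.mem_pi, Set.mem_univ, true_imp_iff, Subtype.forall,
      Set.mem_Iic]
    refine forall₂_congr fun r hr => ?_
    simp only [Function.updateFinset, hr, dif_pos]
    constructor <;> intro h <;> linarith
  simp only [lmarginal, h1]
  rw [lintegral_indicator_one (MeasurableSet.univ_pi fun _ => measurableSet_Iic), Measure.pi_pi]
  simp only [gumbel_Iic hε]
  rw [Finset.prod_coe_sort C fun r => ENNReal.ofReal (Real.exp (-Real.exp (-(ε * (t - s r))))),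
    ← ENNReal.ofReal_prod_of_nonneg (f := fun r => Real.exp (-Real.exp (-(ε * (t - s r)))))
      fun _ _ => (Real.exp_pos _).le, ← Real.exp_sum,
    Finset.sum_neg_distrib, Finset.sum_mul]
  have hsum : ∑ a ∈ C, Real.exp (-(ε * (t - s a))) =
      ∑ a ∈ C, Real.exp (ε * s a) * Real.exp (-(ε * t)) := by
    refine Finset.sum_congr rfl fun a _ => ?_
    rw [← Real.exp_add]
    congr 1
    ring
  rw [hsum]

/-- The coordinate of the head is integrated last: once it is fixed at `v`, the rest is a chain in
`C.erase a` with cap `s a + v`, and `setLIntegral_gumbel` yields the next factor of `plProb`. The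
product form says that the order is independent of the maximum, whose distribution function is the
factor containing `t`. -/
lemma lmarginal_chainEvent (hε : 0 < ε) (s : α → ℝ) (C : Finset α) (l : List α) (hl : l.Nodup)
    (hlC : ∀ a ∈ l, a ∈ C) (t : ℝ) (x : α → ℝ) :
    lmarginal (fun _ => gumbel (1 / ε)) C ((chainEvent s (C \ l.toFinset) l t).indicator 1) x =
      ENNReal.ofReal (plProb (fun a => Real.exp (ε * s a)) C l *
        Real.exp (-((∑ a ∈ C, Real.exp (ε * s a)) * Real.exp (-(ε * t))))) := by
  have := isProbabilityMeasure_gumbel hε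
  induction l generalizing C t x with
  | nil => simpa [chainEvent, plProb] using lmarginal_forall_le hε s C t x
  | cons a l ih =>
    obtain ⟨hal, hl⟩ := List.nodup_cons.1 hl
    have haC : a ∈ C := hlC a (by simp)
    have hlC' : ∀ b ∈ l, b ∈ C.erase a := fun b hb =>
      Finset.mem_erase.2 ⟨fun h => hal (h ▸ hb), hlC b (by simp [hb])⟩
    have hR : C \ (a :: l).toFinset = C.erase a \ l.toFinset := by
      ext b
      simp only [Finset.mem_sdiff, List.mem_toFinset, List.mem_cons, Finset.mem_erase]
      tauto
    rw [hR]
    set R := C.erase a \ l.toFinset with hRdef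
    rw [lmarginal_erase _ (measurable_one.indicator (measurableSet_chainEvent _ _ _ _)) haC]
    have hF : (chainEvent s R (a :: l) t).indicator (1 : (α → ℝ) → ENNReal) = fun z =>
        (fun v z => (Set.Iic (t - s a)).indicator 1 v *
          (chainEvent s R l (s a + v)).indicator 1 z : ℝ → (α → ℝ) → ENNReal) (z a) z := by
      funext z
      have hiff : s a + z a ≤ t ↔ z a ≤ t - s a := by constructor <;> intro h <;> linarith
      by_cases h1 : z a ≤ t - s a <;> by_cases h2 : z ∈ chainEvent s R l (s a + z a) <;>
        simp [Set.indicator, chainEvent, h1, h2, hiff]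
    set W := ∑ b ∈ C.erase a, Real.exp (ε * s b) with hW
    have hW0 : 0 ≤ W := Finset.sum_nonneg fun b _ => (Real.exp_pos _).le
    set p := plProb (fun a => Real.exp (ε * s a)) (C.erase a) l with hp
    have hp0 : 0 < p := plProb_pos (fun _ => Real.exp_pos _) _ _ hl hlC'
    have hin : ∀ v, lmarginal (fun _ => gumbel (1 / ε)) (C.erase a)
        ((chainEvent s R (a :: l) t).indicator 1) (Function.update x a v) =
        (Set.Iic (t - s a)).indicator (fun v => ENNReal.ofReal p * ENNReal.ofReal
          (Real.exp (-((W * Real.exp (-(ε * s a))) * Real.exp (-(ε * v)))))) v := by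
      intro v
      rw [hF]
      refine (lmarginal_eval_of_notMem (Finset.notMem_erase a C) (fun v z =>
        (Set.Iic (t - s a)).indicator 1 v * (chainEvent s R l (s a + v)).indicator 1 z) _).trans ?_
      rw [Function.update_self]
      by_cases hv : v ∈ Set.Iic (t - s a)
      · simp only [Set.indicator_of_mem hv, Pi.one_apply, one_mul]
        rw [ih (C.erase a) hl hlC', ENNReal.ofReal_mul hp0.le, mul_assoc W, ← Real.exp_add]
        congr 6
        ring
      · simp only [Set.indicator_of_notMem hv, zero_mul]
        simp [lmarginal]
    simp only [hin]
    rw [lintegral_indicator measurableSet_Iic, lintegral_const_mul _ (by fun_prop),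
      setLIntegral_gumbel hε (by positivity), ← ENNReal.ofReal_mul hp0.le]
    congr 1
    have hsum : ∑ b ∈ C, Real.exp (ε * s b) = Real.exp (ε * s a) + W :=
      (Finset.add_sum_erase C _ haC).symm
    have hea : Real.exp (-(ε * s a)) = (Real.exp (ε * s a))⁻¹ := Real.exp_neg _
    have hexp : (1 + W * Real.exp (-(ε * s a))) * Real.exp (-(ε * (t - s a))) =
        (Real.exp (ε * s a) + W) * Real.exp (-(ε * t)) := by
      rw [show -(ε * (t - s a)) = ε * s a + -(ε * t) by ring, Real.exp_add, hea]
      field_simp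
    simp only [plProb]
    rw [hexp, hsum, hea]
    have : 0 < Real.exp (ε * s a) := Real.exp_pos _
    rw [← hp]
    field_simp

variable [Fintype α]

lemma pi_gumbel_chainEvent (hε : 0 < ε) (s : α → ℝ) (C : Finset α) (l : List α) (hl : l.Nodup)
    (hlC : ∀ a ∈ l, a ∈ C) (t : ℝ) :
    Measure.pi (fun _ : α => gumbel (1 / ε)) (chainEvent s (C \ l.toFinset) l t) =
      ENNReal.ofReal (plProb (fun a => Real.exp (ε * s a)) C l *
        Real.exp (-((∑ a ∈ C, Real.exp (ε * s a)) * Real.exp (-(ε * t))))) := by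
  have := isProbabilityMeasure_gumbel hε
  have hm := measurableSet_chainEvent s (C \ l.toFinset) l t
  rw [← lintegral_indicator_one hm, lintegral_eq_lmarginal_univ (fun _ => (0 : ℝ)),
    ← Finset.sdiff_union_of_subset (Finset.subset_univ C),
    lmarginal_union _ _ (measurable_one.indicator hm) Finset.sdiff_disjoint]
  rw [funext fun x => lmarginal_chainEvent hε s C l hl hlC t x]
  simp only [lmarginal, lintegral_const, measure_univ, mul_one]

/-- The event that `l` lists the first items of `C`, in decreasing order of the noisy values. -/
def topEvent (s : α → ℝ) (C : Finset α) (l : List α) : Set (α → ℝ) :=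
  {z | (l.Pairwise fun a b => s b + z b ≤ s a + z a) ∧
    ∀ a ∈ l, ∀ r ∈ C \ l.toFinset, s r + z r ≤ s a + z a}

/-- The caps are removed by letting them grow through the naturals. An upper bound suffices, since a
comparison of total masses later forces equality. -/
lemma pi_gumbel_topEvent_le (hε : 0 < ε) (s : α → ℝ) (C : Finset α) (l : List α) (hl : l.Nodup)
    (hlC : ∀ a ∈ l, a ∈ C) :
    Measure.pi (fun _ : α => gumbel (1 / ε)) (topEvent s C l) ≤
      ENNReal.ofReal (plProb (fun a => Real.exp (ε * s a)) C l) := by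
  have hsub : topEvent s C l ⊆ ⋃ n : ℕ, chainEvent s (C \ l.toFinset) l n := by
    rintro z ⟨h1, h2⟩
    obtain ⟨B, hB⟩ := Finite.bddAbove_range fun a => s a + z a
    obtain ⟨n, hn⟩ := exists_nat_ge B
    exact Set.mem_iUnion.2 ⟨n, mem_chainEvent h1 h2 fun a => (hB ⟨a, rfl⟩).trans hn⟩
  refine (measure_mono hsub).trans ?_
  rw [Monotone.measure_iUnion fun m n h => chainEvent_mono (by exact_mod_cast h)]
  refine iSup_le fun n => ?_
  rw [pi_gumbel_chainEvent hε s C l hl hlC]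
  refine ENNReal.ofReal_le_ofReal (mul_le_of_le_one_right
    (plProb_pos (fun _ => Real.exp_pos _) C l hl hlC).le ?_)
  rw [Real.exp_le_one_iff, neg_nonpos]
  exact mul_nonneg (Finset.sum_nonneg fun _ _ => (Real.exp_pos _).le) (Real.exp_pos _).le

end Chain

/-! ### Sorting by noisy values -/

section Sorting

variable {α : Type*}

/-- The list `L` sorted by decreasing value of `v`. -/
def sortBy (v : α → ℝ) (L : List α) : List α :=
  L.mergeSort fun a b => decide (v b ≤ v a)

lemma sortBy_perm (v : α → ℝ) (L : List α) : (sortBy v L).Perm L :=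
  List.mergeSort_perm _ _

lemma pairwise_sortBy (v : α → ℝ) (L : List α) :
    (sortBy v L).Pairwise fun a b => v b ≤ v a := by
  have h := List.pairwise_mergeSort (le := fun a b => decide (v b ≤ v a))
    (fun a b c h1 h2 => by
      simp only [decide_eq_true_eq] at h1 h2 ⊢
      exact h2.trans h1)
    (fun a b => by
      simp only [Bool.or_eq_true, decide_eq_true_eq]
      exact le_total _ _) L
  exact h.imp fun h => by simpa using h

/-- Sorting sees the noise only through the finite table of pairwise comparisons. -/
lemma measurable_comp_sortBy {Y : Type*} [MeasurableSpace Y] [Finite α] (s : α → ℝ) (L : List α)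
    (F : List α → Y) : Measurable fun z : α → ℝ => F (sortBy (fun a => s a + z a) L) := by
  have h1 : Measurable fun (z : α → ℝ) (p : α × α) => decide (s p.2 + z p.2 ≤ s p.1 + z p.1) := by
    refine measurable_pi_lambda _ fun p => measurable_to_bool ?_
    have : (fun z : α → ℝ => decide (s p.2 + z p.2 ≤ s p.1 + z p.1)) ⁻¹' {true} =
        {z | s p.2 + z p.2 ≤ s p.1 + z p.1} := by
      ext z
      simp
    rw [this]
    exact measurableSet_le (by fun_prop) (by fun_prop)
  have h2 : Measurable fun le : α × α → Bool => F (L.mergeSort fun a b => le (a, b)) :=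
    measurable_of_finite _
  exact h2.comp h1

variable [DecidableEq α]

lemma take_sortBy_mem_arrangements (v : α → ℝ) {L : List α} (hL : L.Nodup) {n : ℕ}
    (hn : n ≤ L.length) : (sortBy v L).take n ∈ arrangements n L.toFinset := by
  have hp := sortBy_perm v L
  refine mem_arrangements.2 ⟨?_, ?_, fun a ha => ?_⟩
  · rw [List.length_take, hp.length_eq, min_eq_left hn]
  · exact (hp.nodup_iff.2 hL).sublist (List.take_sublist _ _)
  · exact List.mem_toFinset.2 (hp.mem_iff.1 (List.mem_of_mem_take ha))

lemma setOf_take_sortBy_subset (s : α → ℝ) (L : List α) (n : ℕ) (l : List α) :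
    {z : α → ℝ | (sortBy (fun a => s a + z a) L).take n = l} ⊆ topEvent s L.toFinset l := by
  rintro z rfl
  set m := sortBy (fun a => s a + z a) L with hm
  have h : (m.take n ++ m.drop n).Pairwise fun a b => s b + z b ≤ s a + z a := by
    rw [List.take_append_drop]
    exact pairwise_sortBy _ L
  obtain ⟨h1, -, h3⟩ := List.pairwise_append.1 h
  refine ⟨h1, fun a ha r hr => h3 a ha r ?_⟩
  obtain ⟨hrL, hrn⟩ := Finset.mem_sdiff.1 hr
  have hrm : r ∈ m := (sortBy_perm _ L).mem_iff.2 (List.mem_toFinset.1 hrL)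
  rw [← List.take_append_drop n m, List.mem_append] at hrm
  exact hrm.resolve_left fun h => hrn (List.mem_toFinset.2 h)

variable [Fintype α] {ε : ℝ}

lemma measureReal_comp_take_sortBy {μ : Measure (α → ℝ)}
    [IsProbabilityMeasure μ] (s : α → ℝ) {L : List α} (hL : L.Nodup) {n : ℕ} (hn : n ≤ L.length)
    (P : List α → Prop) [DecidablePred P] :
    μ.real {z | P ((sortBy (fun a => s a + z a) L).take n)} =
      ∑ l ∈ (arrangements n L.toFinset).filter P,
        μ.real {z | (sortBy (fun a => s a + z a) L).take n = l} := by
  rw [← measureReal_biUnion_finset]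
  · congr 1
    ext z
    have hz := take_sortBy_mem_arrangements (fun a => s a + z a) hL hn
    simp [hz]
  · intro l _ l' _ hne
    exact Set.disjoint_left.2 fun z hz hz' => hne (hz.symm.trans hz')
  · intro l _
    exact measurableSet_setOfPred.2 (measurable_comp_sortBy s L fun m => m.take n = l)

/-- The law of the first `n` items in the order of the noisy values. -/
theorem measureReal_take_sortBy (hε : 0 < ε) (s : α → ℝ) {L : List α} (hL : L.Nodup) {n : ℕ}
    (hn : n ≤ L.length) {l : List α} (hl : l ∈ arrangements n L.toFinset) :
    (Measure.pi fun _ : α => gumbel (1 / ε)).real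
        {z | (sortBy (fun a => s a + z a) L).take n = l} =
      plProb (fun a => Real.exp (ε * s a)) L.toFinset l := by
  have := isProbabilityMeasure_gumbel hε
  have hle : ∀ l ∈ arrangements n L.toFinset, (Measure.pi fun _ : α => gumbel (1 / ε)).real
        {z | (sortBy (fun a => s a + z a) L).take n = l} ≤
      plProb (fun a => Real.exp (ε * s a)) L.toFinset l := by
    intro l hl
    obtain ⟨-, hnd, hmem⟩ := mem_arrangements.1 hl
    exact ENNReal.toReal_le_of_le_ofReal (plProb_pos_of_mem (fun _ => Real.exp_pos _) hl).le
      ((measure_mono (setOf_take_sortBy_subset s L n l)).trans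
        (pi_gumbel_topEvent_le hε s _ l hnd hmem))
  have h1 := measureReal_comp_take_sortBy (μ := Measure.pi fun _ : α => gumbel (1 / ε)) s hL hn
    (fun _ => True)
  simp only [Set.ofPred_true, probReal_univ, Finset.filter_true] at h1
  have h2 := sum_plProb (w := fun a => Real.exp (ε * s a)) (fun _ => Real.exp_pos _) n L.toFinset
    (by rwa [List.toFinset_card_of_nodup hL])
  -- Both families sum to 1 and one dominates the other, so they agree termwise; ties need no
  -- separate treatment.
  exact (Finset.sum_eq_sum_iff_of_le hle).1 (h1.symm.trans h2.symm) l hl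

lemma measureReal_le_le (hε : 0 < ε) (s : α → ℝ) {i j : α} (hij : i ≠ j) :
    (Measure.pi fun _ : α => gumbel (1 / ε)).real {z | s j + z j ≤ s i + z i} ≤
      Real.exp (ε * s i) / (Real.exp (ε * s i) + Real.exp (ε * s j)) := by
  have h := pi_gumbel_topEvent_le hε s {i, j} [i] (by simp) (by simp)
  have hev : topEvent s {i, j} [i] = {z | s j + z j ≤ s i + z i} := by
    ext z
    simp [topEvent, hij.symm]
  have hp : plProb (fun a => Real.exp (ε * s a)) {i, j} [i] =
      Real.exp (ε * s i) / (Real.exp (ε * s i) + Real.exp (ε * s j)) := by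
    simp [plProb, Finset.sum_pair hij]
  rw [hev, hp] at h
  exact ENNReal.toReal_le_of_le_ofReal (by positivity) h

/-- The two events `≤` and `≥` for a pair cover the space, while their probabilities are bounded by
numbers adding up to 1. Hence their intersection, the tie, is null. -/
lemma ae_injective (hε : 0 < ε) (s : α → ℝ) :
    ∀ᵐ z ∂(Measure.pi fun _ : α => gumbel (1 / ε)),
      Function.Injective fun a => s a + z a := by
  have := isProbabilityMeasure_gumbel hε
  have key : ∀ i j, i ≠ j → ∀ᵐ z ∂(Measure.pi fun _ : α => gumbel (1 / ε)),
      s i + z i ≠ s j + z j := by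
    intro i j hij
    set μ := Measure.pi fun _ : α => gumbel (1 / ε) with hμ
    have hm : ∀ i j : α, MeasurableSet {z : α → ℝ | s j + z j ≤ s i + z i} := fun i j =>
      measurableSet_le (by fun_prop) (by fun_prop)
    have h1 := measureReal_le_le hε s hij
    have h2 := measureReal_le_le hε s hij.symm
    have h3 := measureReal_union_add_inter (μ := μ) (s := {z | s j + z j ≤ s i + z i})
      (hm j i)
    have h4 : {z : α → ℝ | s j + z j ≤ s i + z i} ∪ {z | s i + z i ≤ s j + z j} = Set.univ :=
      Set.eq_univ_of_forall fun z => le_total (s j + z j) (s i + z i)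
    have h5 : Real.exp (ε * s i) / (Real.exp (ε * s i) + Real.exp (ε * s j)) +
        Real.exp (ε * s j) / (Real.exp (ε * s j) + Real.exp (ε * s i)) = 1 := by
      have := Real.exp_pos (ε * s i)
      have := Real.exp_pos (ε * s j)
      field_simp
      ring
    rw [h4, probReal_univ] at h3
    have h6 : μ.real ({z | s j + z j ≤ s i + z i} ∩ {z | s i + z i ≤ s j + z j}) = 0 :=
      le_antisymm (by linarith) measureReal_nonneg
    rw [measureReal_eq_zero_iff] at h6
    refine measure_mono_null (fun z hz => ?_) h6
    have hz : s i + z i = s j + z j := not_not.1 hz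
    exact ⟨hz.ge, hz.le⟩
  have h : ∀ᵐ z ∂(Measure.pi fun _ : α => gumbel (1 / ε)), ∀ i j, i ≠ j →
      s i + z i ≠ s j + z j := by
    simp only [ae_all_iff]
    exact key
  filter_upwards [h] with z hz i j hij
  exact not_imp_not.1 (hz i j) hij

/-- Privacy of a function of the first `n` items in the order of the noisy values, for a fixed
list of candidates. -/
theorem measureReal_take_sortBy_le (hε : 0 < ε) {s s' : α → ℝ}
    (hs : (∀ a, s a ≤ s' a ∧ s' a ≤ s a + 1) ∨ (∀ a, s' a ≤ s a ∧ s a ≤ s' a + 1))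
    {δ' : ℝ} (hδ' : 0 ≤ δ') (hδ1 : δ' < 1) {L : List α} (hL : L.Nodup) {n k : ℕ} (hk : 1 ≤ k)
    (hnk : n ≤ k) (hn : n ≤ L.length) (P : List α → Prop) :
    (Measure.pi fun _ : α => gumbel (1 / ε)).real
        {z | P ((sortBy (fun a => s a + z a) L).take n)} ≤
      Real.exp (epsPrime k ε δ') * (Measure.pi fun _ : α => gumbel (1 / ε)).real
        {z | P ((sortBy (fun a => s' a + z a) L).take n)} + δ' := by
  classical
  have := isProbabilityMeasure_gumbel hε
  have hw : WeightNeighbor ε (fun a => Real.exp (ε * s a)) fun a => Real.exp (ε * s' a) := by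
    have aux : ∀ x y : ℝ, x ≤ y ∧ y ≤ x + 1 →
        Real.exp (ε * x) ≤ Real.exp (ε * y) ∧
          Real.exp (ε * y) ≤ Real.exp ε * Real.exp (ε * x) := by
      rintro x y ⟨h1, h2⟩
      rw [← Real.exp_add, Real.exp_le_exp, Real.exp_le_exp]
      constructor <;> nlinarith
    exact hs.imp (fun h a => aux _ _ (h a)) fun h a => aux _ _ (h a)
  have hlaw : ∀ s : α → ℝ, (Measure.pi fun _ : α => gumbel (1 / ε)).real
        {z | P ((sortBy (fun a => s a + z a) L).take n)} =
      ∑ l ∈ (arrangements n L.toFinset).filter P,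
        plProb (fun a => Real.exp (ε * s a)) L.toFinset l := by
    intro s
    rw [measureReal_comp_take_sortBy s hL hn P]
    exact Finset.sum_congr rfl fun l hl =>
      measureReal_take_sortBy hε s hL hn (Finset.mem_filter.1 hl).1
  rw [hlaw, hlaw]
  exact hw.sum_plProb_filter_le (fun _ => Real.exp_pos _) (fun _ => Real.exp_pos _) hε hδ' hδ1
    hk hnk _ (by rwa [List.toFinset_card_of_nodup hL]) P

end Sorting

/-! ### Dependence of the output on the sorted list -/

section Truncate

variable {d : ℕ}

lemma takeWhile_isSome_take (k : ℕ) (l : List (Option (Fin d))) :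
    (l.take k).takeWhile (fun o => o.isSome) = (l.takeWhile fun o => o.isSome).take k := by
  induction l generalizing k with
  | nil => simp
  | cons a l ih =>
    cases k with
    | zero => simp
    | succ k => cases a <;> simp [ih]

/-- The output is a function of the first `k` items. -/
lemma truncate_take (k : ℕ) (l : List (Option (Fin d))) :
    truncate k l = if ((l.take k).takeWhile fun o => o.isSome).length < k then
      (l.take k).takeWhile (fun o => o.isSome) ++ [none] else l.take k := by
  rw [takeWhile_isSome_take]
  simp only [truncate, List.length_take]
  by_cases h : (l.takeWhile fun o => o.isSome).length < k
  · rw [if_pos h, if_pos (by omega), List.take_of_length_le h.le]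
  · rw [if_neg h, if_neg (by omega)]
    obtain ⟨m, hm⟩ := List.takeWhile_prefix (l := l) fun o => o.isSome
    conv_rhs => rw [← hm]
    rw [List.take_append_of_le_length (not_lt.1 h)]

/-- The items listed before `⊥` only depend on the candidates with a value above that of `⊥`. -/
lemma takeWhile_sortBy_eq {v : Option (Fin d) → ℝ} (hv : Function.Injective v)
    {L L' : List (Option (Fin d))} (hL : L.Nodup) (hL' : L'.Nodup) (hn : none ∈ L)
    (hn' : none ∈ L') (h : ∀ o, v none < v o → (o ∈ L ↔ o ∈ L')) :
    (sortBy v L).takeWhile (fun o => o.isSome) = (sortBy v L').takeWhile fun o => o.isSome := by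
  have hmem : ∀ M : List (Option (Fin d)), M.Nodup → none ∈ M → ∀ o,
      o ∈ (sortBy v M).takeWhile (fun o => o.isSome) ↔ o ∈ M ∧ v none < v o := by
    intro M hM hnM o
    have hp := sortBy_perm v M
    have hsort := pairwise_sortBy v M
    have hnd := hp.nodup_iff.2 hM
    have hne : none ∈ sortBy v M := hp.mem_iff.2 hnM
    rw [← hp.mem_iff]
    generalize sortBy v M = m at hsort hnd hne
    induction m with
    | nil => simp at hne
    | cons a m ih =>
      obtain ⟨h1, h2⟩ := List.pairwise_cons.1 hsort
      obtain ⟨h3, h4⟩ := List.nodup_cons.1 hnd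
      cases a with
      | none =>
        simp only [List.takeWhile_cons, Option.isSome_none, Bool.false_eq_true, if_false,
          List.not_mem_nil, List.mem_cons, false_iff, not_and, not_lt]
        rintro (rfl | ho)
        · exact le_rfl
        · exact h1 o ho
      | some i =>
        have hne' : none ∈ m := by simpa using hne
        have hlt : v none < v (some i) := lt_of_le_of_ne (h1 _ hne') fun he => by
          simpa using hv he
        simp only [List.takeWhile_cons, Option.isSome_some, if_true, List.mem_cons,
          ih h2 h4 hne']
        constructor
        · rintro (rfl | ⟨ho, hvo⟩)
          · exact ⟨Or.inl rfl, hlt⟩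
          · exact ⟨Or.inr ho, hvo⟩
        · rintro ⟨rfl | ho, hvo⟩
          · exact Or.inl rfl
          · exact Or.inr ⟨ho, hvo⟩
  have hnd : ∀ M : List (Option (Fin d)), M.Nodup →
      ((sortBy v M).takeWhile fun o => o.isSome).Nodup := fun M hM =>
    ((sortBy_perm v M).nodup_iff.2 hM).sublist (List.takeWhile_sublist _)
  have hsorted : ∀ M : List (Option (Fin d)),
      ((sortBy v M).takeWhile fun o => o.isSome).Pairwise fun a b => v b ≤ v a := fun M =>
    (pairwise_sortBy v M).sublist (List.takeWhile_sublist _)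
  refine List.Perm.eq_of_pairwise (le := fun a b => v b ≤ v a)
    (fun a b _ _ h1 h2 => hv (le_antisymm h2 h1)) (hsorted L) (hsorted L') ?_
  rw [List.perm_ext_iff_of_nodup (hnd L hL) (hnd L' hL')]
  intro o
  rw [hmem L hL hn, hmem L' hL' hn']
  exact ⟨fun ⟨h1, h2⟩ => ⟨(h o h2).1 h1, h2⟩, fun ⟨h1, h2⟩ => ⟨(h o h2).2 h1, h2⟩⟩

end Truncate

/-! ### Ranked counts and candidates -/

/-- In a decreasing list the entries at least `t` form an initial segment. The index must be in
range, since the default 0 would satisfy `t ≤ 0` at `t = 0`. -/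
lemma le_getD_iff_lt_countP {l : List ℕ} (hl : l.Pairwise fun a b => b ≤ a) {n : ℕ}
    (hn : n < l.length) (t : ℕ) : t ≤ l.getD n 0 ↔ n < l.countP fun a => decide (t ≤ a) := by
  induction l generalizing n with
  | nil => simp at hn
  | cons a l ih =>
    obtain ⟨ha, hl⟩ := List.pairwise_cons.1 hl
    by_cases hta : t ≤ a
    · rw [List.countP_cons_of_pos (by simpa using hta)]
      cases n with
      | zero => simpa using hta
      | succ n =>
        rw [List.getD_cons_succ, ih hl (by simpa using hn)]
        omega
    · have h0 : (l.countP fun a => decide (t ≤ a)) = 0 :=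
        List.countP_eq_zero.2 fun b hb => by simpa using (ha b hb).trans_lt (not_le.1 hta)
      rw [List.countP_cons_of_neg (by simpa using hta), h0]
      simp only [not_lt_zero, iff_false, not_le]
      cases n with
      | zero => simpa using hta
      | succ n =>
        rw [List.getD_cons_succ, List.getD_eq_getElem _ _ (by simpa using hn)]
        exact (ha _ (List.getElem_mem _)).trans_lt (not_le.1 hta)

section Histogram

variable {d kbar : ℕ} {h h' : Fin d → ℕ}

/-- Describes the ranked count by counting alone, so that its monotonicity and sensitivity follow
from comparing counts without following the sort. -/
lemma le_rankedCount_iff (hd : kbar < d) (h : Fin d → ℕ) (t : ℕ) :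
    t ≤ rankedCount h (kbar + 1) ↔
      kbar < (List.finRange d).countP fun i => decide (t ≤ h i) := by
  have hsort : ((List.ofFn h).mergeSort fun a b => decide (b ≤ a)).Pairwise fun a b => b ≤ a := by
    have := List.pairwise_mergeSort (le := fun a b : ℕ => decide (b ≤ a))
      (fun a b c h1 h2 => by
        simp only [decide_eq_true_eq] at h1 h2 ⊢
        exact h2.trans h1)
      (fun a b => by
        simp only [Bool.or_eq_true, decide_eq_true_eq]
        exact le_total _ _) (List.ofFn h)
    exact this.imp fun h => by simpa using h
  rw [rankedCount, Nat.add_sub_cancel, le_getD_iff_lt_countP hsort (by simpa using hd),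
    (List.mergeSort_perm _ _).countP_eq, List.ofFn_eq_map, List.countP_map]
  rfl

lemma countP_rankedCount_lt_le (hd : kbar < d) (h : Fin d → ℕ) :
    ((List.finRange d).countP fun i => decide (rankedCount h (kbar + 1) < h i)) ≤ kbar := by
  by_contra hlt
  have := (le_rankedCount_iff hd h (rankedCount h (kbar + 1) + 1)).2 (not_le.1 hlt)
  omega

lemma rankedCount_mono (hd : kbar < d) (hh : ∀ i, h i ≤ h' i) :
    rankedCount h (kbar + 1) ≤ rankedCount h' (kbar + 1) := by
  rw [le_rankedCount_iff hd]
  refine ((le_rankedCount_iff hd h _).1 le_rfl).trans_le (List.countP_mono_left fun i _ hi => ?_)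
  simp only [decide_eq_true_eq] at hi ⊢
  exact hi.trans (hh i)

lemma rankedCount_le_add_one (hd : kbar < d) (hh : ∀ i, h' i ≤ h i + 1) :
    rankedCount h' (kbar + 1) ≤ rankedCount h (kbar + 1) + 1 := by
  rw [← Nat.sub_le_iff_le_add, le_rankedCount_iff hd]
  refine ((le_rankedCount_iff hd h' _).1 le_rfl).trans_le (List.countP_mono_left fun i _ hi => ?_)
  simp only [decide_eq_true_eq] at hi ⊢
  have := hh i
  omega

/-- Two histograms that differ by at most one in each count, all in the same direction. -/
def HistNeighbor (h h' : Fin d → ℕ) : Prop :=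
  (∀ i, h i ≤ h' i ∧ h' i ≤ h i + 1) ∨ (∀ i, h' i ≤ h i ∧ h i ≤ h' i + 1)

lemma Neighbor.histNeighbor {x x' : Multiset (Finset (Fin d))} (hx : Neighbor x x') :
    HistNeighbor (histogram x) (histogram x') := by
  have aux : ∀ (r : Finset (Fin d)) (y : Multiset (Finset (Fin d))) (i : Fin d),
      histogram y i ≤ histogram (r ::ₘ y) i ∧ histogram (r ::ₘ y) i ≤ histogram y i + 1 := by
    intro r y i
    simp only [histogram, Multiset.countP_cons]
    split <;> omega
  obtain ⟨r, rfl | rfl⟩ := hx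
  · exact Or.inr fun i => aux r x' i
  · exact Or.inl fun i => aux r x i

lemma HistNeighbor.rankedCount (hd : kbar < d) (hh : HistNeighbor h h') :
    (rankedCount h (kbar + 1) ≤ rankedCount h' (kbar + 1) ∧
        rankedCount h' (kbar + 1) ≤ rankedCount h (kbar + 1) + 1 ∧
        ∀ i, h i ≤ h' i ∧ h' i ≤ h i + 1) ∨
      (rankedCount h' (kbar + 1) ≤ rankedCount h (kbar + 1) ∧
        rankedCount h (kbar + 1) ≤ rankedCount h' (kbar + 1) + 1 ∧
        ∀ i, h' i ≤ h i ∧ h i ≤ h' i + 1) :=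
  hh.imp
    (fun hh => ⟨rankedCount_mono hd fun i => (hh i).1,
      rankedCount_le_add_one hd fun i => (hh i).2, hh⟩)
    fun hh => ⟨rankedCount_mono hd fun i => (hh i).1,
      rankedCount_le_add_one hd fun i => (hh i).2, hh⟩

/-- The indices which are candidates for exactly one of the two histograms. -/
def unsharedCandidates (kbar : ℕ) (h h' : Fin d → ℕ) : List (Fin d) :=
  (List.finRange d).filter fun i =>
    decide ¬(DPTopK.rankedCount h (kbar + 1) < h i ↔ DPTopK.rankedCount h' (kbar + 1) < h' i)

lemma HistNeighbor.length_unsharedCandidates_le (hd : kbar < d) (hh : HistNeighbor h h') :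
    (unsharedCandidates kbar h h').length ≤ kbar := by
  rw [unsharedCandidates, ← List.countP_eq_length_filter]
  set τ := DPTopK.rankedCount h (kbar + 1) with hτ
  set τ' := DPTopK.rankedCount h' (kbar + 1) with hτ'
  -- When counts increase and the threshold stays, no candidate is lost; when the threshold rises by
  -- 1, none is gained. So all unshared indices are candidates on one and the same side, which has
  -- at most `kbar` of them.
  have hsub : (∀ i, ¬(τ < h i ↔ τ' < h' i) → τ < h i) ∨
      (∀ i, ¬(τ < h i ↔ τ' < h' i) → τ' < h' i) := by
    by_contra! hcon
    obtain ⟨⟨i, hi, hi'⟩, j, hj, hj'⟩ := hcon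
    rcases hh.rankedCount hd with ⟨h1, h2, h3⟩ | ⟨h1, h2, h3⟩ <;>
    · have := h3 i
      have := h3 j
      omega
  rcases hsub with hsub | hsub
  · refine (List.countP_mono_left fun i _ hi => ?_).trans (countP_rankedCount_lt_le hd h)
    simp only [decide_eq_true_eq] at hi ⊢
    exact hsub i hi
  · refine (List.countP_mono_left fun i _ hi => ?_).trans (countP_rankedCount_lt_le hd h')
    simp only [decide_eq_true_eq] at hi ⊢
    exact hsub i hi

/-- This is what the summand 1 in the score of `⊥` compensates: an unshared index is then below `⊥`
by at least `ln (kbar / δ) / ε`. -/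
lemma HistNeighbor.le_of_mem_unsharedCandidates (hd : kbar < d) (hh : HistNeighbor h h')
    {i : Fin d} (hi : i ∈ unsharedCandidates kbar h h') :
    h i ≤ DPTopK.rankedCount h (kbar + 1) + 1 := by
  have hi := (List.mem_filter.1 hi).2
  simp only [decide_eq_true_eq] at hi
  rcases hh.rankedCount hd with ⟨h1, h2, h3⟩ | ⟨h1, h2, h3⟩ <;>
  · have := h3 i
    omega

lemma none_mem_candidates : none ∈ candidates kbar h := by
  simp [candidates]

lemma some_mem_candidates {i : Fin d} :
    some i ∈ candidates kbar h ↔ DPTopK.rankedCount h (kbar + 1) < h i := by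
  simp [candidates]

lemma nodup_candidates : (candidates kbar h).Nodup := by
  refine List.nodup_cons.2 ⟨by simp, ?_⟩
  exact ((List.nodup_finRange d).filter _).map (Option.some_injective _)

lemma HistNeighbor.score (hd : kbar < d) (hh : HistNeighbor h h') (ε δ : ℝ) :
    (∀ o, score kbar ε δ h o ≤ score kbar ε δ h' o ∧
        score kbar ε δ h' o ≤ score kbar ε δ h o + 1) ∨
      (∀ o, score kbar ε δ h' o ≤ score kbar ε δ h o ∧
        score kbar ε δ h o ≤ score kbar ε δ h' o + 1) := by
  refine (hh.rankedCount hd).imp ?_ ?_ <;>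
  · rintro ⟨h1, h2, h3⟩ (_ | i)
    · have h1 : ((_ : ℕ) : ℝ) ≤ _ := Nat.cast_le.2 h1
      have h2 : ((_ : ℕ) : ℝ) ≤ _ := Nat.cast_le.2 h2
      push_cast at h2
      simp only [DPTopK.score]
      constructor <;> linarith
    · simp only [DPTopK.score]
      exact_mod_cast h3 i

/-! ### Privacy of the strictly limited domain algorithm -/

/-- The output when the noisy values are those of `h` and the candidates are listed in `L`. -/
def outputOn (k kbar : ℕ) (ε δ : ℝ) (h : Fin d → ℕ) (L : List (Option (Fin d)))
    (z : Option (Fin d) → ℝ) : Output d :=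
  truncate k (sortBy (fun o => DPTopK.score kbar ε δ h o + z o) L)

variable {k : ℕ} {ε δ δ' : ℝ}

/-- Exchanging the candidates for those of a neighbor costs at most `δ`. -/
lemma HistNeighbor.measureReal_outputOn_le (hkbar : 1 ≤ kbar) (hd : kbar < d) (hε : 0 < ε)
    (hδ : 0 < δ) (hh : HistNeighbor h h') (S : Set (Output d)) :
    (Measure.pi fun _ : Option (Fin d) => gumbel (1 / ε)).real
        {z | outputOn k kbar ε δ h (candidates kbar h) z ∈ S} ≤
      (Measure.pi fun _ : Option (Fin d) => gumbel (1 / ε)).real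
        {z | outputOn k kbar ε δ h (candidates kbar h') z ∈ S} + δ := by
  have := isProbabilityMeasure_gumbel hε
  set μ := Measure.pi fun _ : Option (Fin d) => gumbel (1 / ε) with hμ
  set s := DPTopK.score kbar ε δ h with hs
  set U := unsharedCandidates kbar h h' with hU
  -- Some unshared candidate reaches the noisy value of `⊥`; outside this event the two lists agree
  -- above `⊥`.
  set bad : Set (Option (Fin d) → ℝ) :=
    ⋃ i ∈ U.toFinset, {z | s none + z none ≤ s (some i) + z (some i)} with hbad
  have hkb : (0 : ℝ) < kbar := by exact_mod_cast hkbar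
  have hone : ∀ i ∈ U.toFinset,
      μ.real {z | s none + z none ≤ s (some i) + z (some i)} ≤ δ / kbar := by
    intro i hi
    refine (measureReal_le_le hε s (Option.some_ne_none i)).trans ?_
    have hle : (h i : ℝ) ≤ DPTopK.rankedCount h (kbar + 1) + 1 := by
      exact_mod_cast hh.le_of_mem_unsharedCandidates hd (List.mem_toFinset.1 hi)
    calc _ ≤ Real.exp (ε * s (some i)) / Real.exp (ε * s none) :=
          div_le_div_of_nonneg_left (Real.exp_pos _).le (Real.exp_pos _)
            (le_add_of_nonneg_left (Real.exp_pos _).le)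
      _ = Real.exp (ε * (s (some i) - s none)) := by rw [← Real.exp_sub, mul_sub]
      _ ≤ Real.exp (-Real.log (kbar / δ)) := by
          refine Real.exp_le_exp.2 ?_
          have h1 : s (some i) - s none ≤ -(Real.log (kbar / δ) / ε) := by
            simp only [hs, DPTopK.score]
            linarith
          calc _ ≤ ε * -(Real.log (kbar / δ) / ε) := mul_le_mul_of_nonneg_left h1 hε.le
            _ = _ := by field_simp
      _ = δ / kbar := by
          rw [← Real.log_inv, inv_div, Real.exp_log (div_pos hδ hkb)]
  have hbadle : μ.real bad ≤ δ := by
    calc μ.real bad ≤ ∑ i ∈ U.toFinset, μ.real {z | s none + z none ≤ s (some i) + z (some i)} :=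
          measureReal_biUnion_finset_le _ _
      _ ≤ ∑ _i ∈ U.toFinset, δ / kbar := Finset.sum_le_sum hone
      _ = U.toFinset.card * (δ / kbar) := by rw [Finset.sum_const, nsmul_eq_mul]
      _ ≤ kbar * (δ / kbar) := by
          refine mul_le_mul_of_nonneg_right ?_ (div_pos hδ hkb).le
          exact_mod_cast U.toFinset_card_le.trans (hh.length_unsharedCandidates_le hd)
      _ = δ := mul_div_cancel₀ _ hkb.ne'
  have hae : ({z | outputOn k kbar ε δ h (candidates kbar h) z ∈ S} : Set _) ≤ᵐ[μ]
      ({z | outputOn k kbar ε δ h (candidates kbar h') z ∈ S} ∪ bad : Set _) := by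
    filter_upwards [ae_injective hε s] with z hz hzS
    by_cases hzb : z ∈ bad
    · exact Or.inr hzb
    · refine Or.inl ?_
      have heq := takeWhile_sortBy_eq hz (nodup_candidates (kbar := kbar) (h := h))
        (nodup_candidates (kbar := kbar) (h := h')) none_mem_candidates none_mem_candidates
        (by
          rintro (_ | i) ho
          · exact iff_of_true none_mem_candidates none_mem_candidates
          · rw [some_mem_candidates, some_mem_candidates]
            by_contra hi
            refine hzb (Set.mem_iUnion₂.2 ⟨i, ?_, ho.le⟩)
            simpa [hU, unsharedCandidates] using hi)
      have hout : outputOn k kbar ε δ h (candidates kbar h') z =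
          outputOn k kbar ε δ h (candidates kbar h) z := by
        simp only [outputOn, truncate, ← hs, heq]
      show outputOn k kbar ε δ h (candidates kbar h') z ∈ S
      rw [hout]
      exact hzS
  calc _ ≤ μ.real ({z | outputOn k kbar ε δ h (candidates kbar h') z ∈ S} ∪ bad) :=
        ENNReal.toReal_mono (measure_ne_top _ _) (measure_mono_ae hae)
    _ ≤ _ := (measureReal_union_le _ _).trans (add_le_add le_rfl hbadle)

/-- With a fixed list of candidates the output is private. -/
lemma HistNeighbor.measureReal_outputOn_le_exp (hk : 1 ≤ k) (hd : kbar < d) (hε : 0 < ε)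
    (hδ' : 0 ≤ δ') (hδ1 : δ' < 1) (hh : HistNeighbor h h') {L : List (Option (Fin d))}
    (hL : L.Nodup) (S : Set (Output d)) :
    (Measure.pi fun _ : Option (Fin d) => gumbel (1 / ε)).real
        {z | outputOn k kbar ε δ h L z ∈ S} ≤
      Real.exp (epsPrime k ε δ') * (Measure.pi fun _ : Option (Fin d) => gumbel (1 / ε)).real
        {z | outputOn k kbar ε δ h' L z ∈ S} + δ' := by
  -- There may be fewer than `k` candidates, hence the minimum. The predicate is the form of
  -- truncation from `truncate_take`, which reads only the first `k` items.
  have := measureReal_take_sortBy_le hε (hh.score hd ε δ) hδ' hδ1 hL hk (min_le_left k L.length)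
    (min_le_right k L.length) fun m => (if (m.takeWhile fun o => o.isSome).length < k then
      m.takeWhile (fun o => o.isSome) ++ [none] else m) ∈ S
  have htake : ∀ v : Option (Fin d) → ℝ,
      (sortBy v L).take (min k L.length) = (sortBy v L).take k := by
    intro v
    rw [← (sortBy_perm v L).length_eq, ← List.take_eq_take_min]
  simp only [htake, ← truncate_take] at this
  exact this

lemma measurable_outputOfNoise (k kbar : ℕ) (ε δ : ℝ) (h : Fin d → ℕ) :
    Measurable (outputOfNoise k kbar ε δ h) :=
  measurable_comp_sortBy (DPTopK.score kbar ε δ h) (candidates kbar h) (truncate k)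

end Histogram

end DPTopK

end

theorem mainTheorem8 (d k kbar : ℕ) (hk : 1 ≤ k) (hkbar : k ≤ kbar) (hd : kbar < d)
    (ε δ δ' : ℝ) (hε : 0 < ε) (hδ : 0 < δ) (hδ' : 0 ≤ δ') :
    DPTopK.IsDP (DPTopK.strictTopK d k kbar ε δ) (DPTopK.epsPrime k ε δ') (δ + δ') := by
  have := DPTopK.isProbabilityMeasure_gumbel hε
  have hprob : ∀ x, MeasureTheory.IsProbabilityMeasure (DPTopK.strictTopK d k kbar ε δ x) :=
    fun x => MeasureTheory.Measure.isProbabilityMeasure_map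
      (DPTopK.measurable_outputOfNoise k kbar ε δ _).aemeasurable
  refine ⟨hprob, fun x x' hx S hS => ?_⟩
  rcases lt_or_ge δ' 1 with hδ1 | hδ1
  · have hh := hx.histNeighbor
    have hmap : ∀ x, (DPTopK.strictTopK d k kbar ε δ x).real S =
        (MeasureTheory.Measure.pi fun _ : Option (Fin d) => DPTopK.gumbel (1 / ε)).real
          {z | DPTopK.outputOn k kbar ε δ (DPTopK.histogram x)
            (DPTopK.candidates kbar (DPTopK.histogram x)) z ∈ S} := fun x =>
      MeasureTheory.map_measureReal_apply (DPTopK.measurable_outputOfNoise k kbar ε δ _) hS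
    -- The list is exchanged under the scores of `x`, then the scores are changed for the list of
    -- `x'`; the additive errors simply add.
    have h1 := hh.measureReal_outputOn_le (k := k) (hk.trans hkbar) hd hε hδ S
    have h2 := hh.measureReal_outputOn_le_exp (δ := δ) hk hd hε hδ' hδ1
      (DPTopK.nodup_candidates (kbar := kbar) (h := DPTopK.histogram x')) S
    rw [hmap, hmap]
    linarith
  · have h1 : (DPTopK.strictTopK d k kbar ε δ x).real S ≤ 1 := MeasureTheory.measureReal_le_one
    have h2 : 0 ≤ Real.exp (DPTopK.epsPrime k ε δ') * (DPTopK.strictTopK d k kbar ε δ x').real S :=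
      mul_nonneg (Real.exp_pos _).le MeasureTheory.measureReal_nonneg
    linarith
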